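/- Let $\mathbb K$ be a field, $d\ge 0$ an integer, $\mathcal A$ a $\mathbb K$-algebra isomorphic to $\mathrm{Mat}_{d+1}(\mathbb K)$, $\mathrm{tr}$ the trace on $\mathcal A$, and $V$ an irreducible left $\mathcal A$-module. Let $\Phi=(A;\{E_i\}_{i=0}^d;A^*;\{E^*_i\}_{i=0}^d)$ be a Leonard system in $\mathcal A$. That is, each of $A,A^*\in\mathcal A$ has $d+1$ mutually distinct eigenvalues in $\mathbb K$; for an ordering $\{\theta_i\}_{i=0}^d$ (resp. $\{\theta^*_i\}_{i=0}^d$) of the eigenvalues of $A$ (resp. $A^*$), $$E_i=\prod_{j\ne i}\frac{A-\theta_jI}{\theta_i-\theta_j},\qquad E^*_i=\prod_{j\ne i}\frac{A^*-\theta^*_jI}{\theta^*_i-\theta^*_j}\qquad(0\le i\le d);$$ and for $0\le i,j\le d$ each of $E_iA^*E_j$, $E^*_iAE^*_j$ is zero if $|i-j|>1$ and nonzero if $|i-j|=1$. For $0\le i\le d$ put $$\tau_i=\prod_{h=0}^{i-1}(\lambda-\theta_h),\quad \eta_i=\prod_{h=0}^{i-1}(\lambda-\theta_{d-h}),\quad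 \tau^*_i=\prod_{h=0}^{i-1}(\lambda-\theta^*_h),\quad \eta^*_i=\prod_{h=0}^{i-1}(\lambda-\theta^*_{d-h}),$$ and let $$\varphi=\varphi_1\varphi_2\cdots\varphi_d,\qquad \varphi_i=(\theta^*_0-\theta^*_i)\frac{\mathrm{tr}(\tau_i(A)E^*_0)}{\mathrm{tr}(\tau_{i-1}(A)E^*_0)}\quad(1\le i\le d).$$ Let $\dagger$ be the antiautomorphism of $\mathcal A$ that fixes $A$ and $A^*$, and let $\langle\,,\rangle$ be a bilinear form on $V$ associated with $\dagger$, that is, a nonzero bilinear form with $\langle Xu,v\rangle=\langle u,X^\dagger v\rangle$ for all $X\in\mathcal A$ and $u,v\in V$. Let $\xi_0\in E_0V$, $\xi_d\in E_dV$, $\xi^*_0\in E^*_0V$, $\xi^*_d\in E^*_dV$ be nonzero vectors. Then all denominators above and below are nonzero, and the following hold. (i) Let $\{X_i\}_{i=0}^d$ be one of $\{E_i\}$, $\{E_{d-i}\}$, $\{\tau_i(A)\}$, $\{\tau_{d-i}(A)\}$, $\{\eta_i(A)\}$, $\{\eta_{d-i}(A)\}$ (each with $0\le i\le d$). Then for $0\le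 i\le d$, $$\frac{\eta^*_d(\theta^*_0)}{\varphi}\frac{\langle\xi_d,\xi^*_0\rangle}{\langle\xi_d,\xi^*_d\rangle}\sum_{r=0}^d\tau_r(\theta_r)\eta_{d-r}(\theta_r)X_rE^*_0E_r\cdot E_i\xi^*_d=X_i\xi^*_0,$$ $$\sum_{r=0}^d\frac{X_rE^*_dE_r}{\mathrm{tr}(E_rE^*_d)}\cdot E_i\xi^*_d=X_i\xi^*_d,$$ $$\frac{\eta^*_d(\theta^*_0)}{\varphi}\frac{\langle\xi_d,\xi^*_0\rangle}{\langle\xi_d,\xi^*_d\rangle}\sum_{r=0}^d\tau_r(\theta_r)\eta_{d-r}(\theta_r)X_{d-r}E^*_0E_r\cdot E_{d-i}\xi^*_d=X_i\xi^*_0,$$ $$\sum_{r=0}^d\frac{X_{d-r}E^*_dE_r}{\mathrm{tr}(E_rE^*_d)}\cdot E_{d-i}\xi^*_d=X_i\xi^*_d.$$ (ii) Let $\{X_i\}_{i=0}^d$ be one of $\{E^*_i\}$, $\{E^*_{d-i}\}$, $\{\tau^*_i(A^*)\}$, $\{\tau^*_{d-i}(A^*)\}$, $\{\eta^*_i(A^*)\}$,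 $\{\eta^*_{d-i}(A^*)\}$ (each with $0\le i\le d$). Then for $0\le i\le d$, $$\frac{\langle\xi_0,\xi_0\rangle}{\langle\xi_0,\xi^*_d\rangle}\sum_{r=0}^d\frac{X_rE_0E^*_dE_r}{\mathrm{tr}(E_rE^*_d)}\cdot E_i\xi^*_d=X_i\xi_0,$$ $$\frac{\langle\xi_d,\xi_d\rangle}{\langle\xi_d,\xi^*_d\rangle}\sum_{r=0}^d\frac{X_rE_dE^*_dE_r}{\mathrm{tr}(E_rE^*_d)}\cdot E_i\xi^*_d=X_i\xi_d,$$ $$\frac{\langle\xi_0,\xi_0\rangle}{\langle\xi_0,\xi^*_d\rangle}\sum_{r=0}^d\frac{X_{d-r}E_0E^*_dE_r}{\mathrm{tr}(E_rE^*_d)}\cdot E_{d-i}\xi^*_d=X_i\xi_0,$$ $$\frac{\langle\xi_d,\xi_d\rangle}{\langle\xi_d,\xi^*_d\rangle}\sum_{r=0}^d\frac{X_{d-r}E_dE^*_dE_r}{\mathrm{tr}(E_rE^*_d)}\cdot E_{d-i}\xi^*_d=X_i\xi_d.$$ -/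

import Mathlib

open Polynomial

/-- `θ` lists `d + 1` mutually distinct eigenvalues of `A` (so `A` is multiplicity-free when the
ambient algebra is isomorphic to `Mat_{d+1}(K)`), and `E i` is the primitive idempotent of `A`
associated with `θ i`, that is `E i = ∏_{j ≠ i} (A - θ j) / (θ i - θ j)`.
Here `Lagrange.basis Finset.univ θ i` is the polynomial
`∏_{j ≠ i} (θ i - θ j)⁻¹ (X - θ j)`. -/
structure IsPrimitiveIdempotents {K 𝒜 : Type*} [Field K] [Ring 𝒜] [Algebra K 𝒜] {d : ℕ}
    (A : 𝒜) (θ : Fin (d + 1) → K) (E : Fin (d + 1) → 𝒜) : Prop where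
  injective : Function.Injective θ
  mem_spectrum : ∀ i, θ i ∈ spectrum K A
  eq_aeval : ∀ i, E i = aeval A (Lagrange.basis Finset.univ θ i)

/-- A Leonard system `(A; {E_i}; A^*; {E^*_i})` of diameter `d` in `𝒜`, together with its eigenvalue
sequence `θ` and its dual eigenvalue sequence `θs` (which are determined by the other data).
The letter `s` stands for the superscript `*`. -/
structure LeonardSystem (K 𝒜 : Type*) [Field K] [Ring 𝒜] [Algebra K 𝒜] (d : ℕ) where
  A : 𝒜
  E : Fin (d + 1) → 𝒜
  As : 𝒜
  Es : Fin (d + 1) → 𝒜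
  θ : Fin (d + 1) → K
  θs : Fin (d + 1) → K
  idem : IsPrimitiveIdempotents A θ E
  idem_s : IsPrimitiveIdempotents As θs Es
  E_As_E_zero : ∀ i j : Fin (d + 1), 1 < |(i.val : ℤ) - (j.val : ℤ)| → E i * As * E j = 0
  E_As_E_ne : ∀ i j : Fin (d + 1), |(i.val : ℤ) - (j.val : ℤ)| = 1 → E i * As * E j ≠ 0
  Es_A_Es_zero : ∀ i j : Fin (d + 1), 1 < |(i.val : ℤ) - (j.val : ℤ)| → Es i * A * Es j = 0
  Es_A_Es_ne : ∀ i j : Fin (d + 1), |(i.val : ℤ) - (j.val : ℤ)| = 1 → Es i * A * Es j ≠ 0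

/-- `τ_i = (λ - θ_0)(λ - θ_1) ⋯ (λ - θ_{i-1})`. -/
noncomputable def tauPoly {K : Type*} [Field K] {d : ℕ} (θ : Fin (d + 1) → K) (i : ℕ) : K[X] :=
  ∏ h : Fin (d + 1) with h.val < i, (X - C (θ h))

/-- `η_i = (λ - θ_d)(λ - θ_{d-1}) ⋯ (λ - θ_{d-i+1})`. -/
noncomputable def etaPoly {K : Type*} [Field K] {d : ℕ} (θ : Fin (d + 1) → K) (i : ℕ) : K[X] :=
  ∏ h : Fin (d + 1) with d < h.val + i, (X - C (θ h))

/-- The trace on an algebra identified with `Mat_{d+1}(K)`. -/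
def algTrace {K 𝒜 : Type*} [Field K] [Ring 𝒜] [Algebra K 𝒜] {d : ℕ}
    (e : 𝒜 ≃ₐ[K] Matrix (Fin (d + 1)) (Fin (d + 1)) K) (Y : 𝒜) : K :=
  (e Y).trace

namespace LeonardSystem

/-- `tr(τ_i(A) E^*_0)`. -/
noncomputable def splitTrace {K 𝒜 : Type*} [Field K] [Ring 𝒜] [Algebra K 𝒜] {d : ℕ}
    (e : 𝒜 ≃ₐ[K] Matrix (Fin (d + 1)) (Fin (d + 1)) K) (Φ : LeonardSystem K 𝒜 d) (i : ℕ) : K :=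
  algTrace e (aeval Φ.A (tauPoly Φ.θ i) * Φ.Es 0)

/-- The first split sequence: for `i = 0, …, d - 1`, `firstSplit e Φ i` is the scalar
`φ_{i+1} = (θ^*_0 - θ^*_{i+1}) tr(τ_{i+1}(A) E^*_0) / tr(τ_i(A) E^*_0)`. -/
noncomputable def firstSplit {K 𝒜 : Type*} [Field K] [Ring 𝒜] [Algebra K 𝒜] {d : ℕ}
    (e : 𝒜 ≃ₐ[K] Matrix (Fin (d + 1)) (Fin (d + 1)) K) (Φ : LeonardSystem K 𝒜 d) (i : Fin d) : K :=
  (Φ.θs 0 - Φ.θs i.succ) * (splitTrace e Φ (i + 1) / splitTrace e Φ i)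

/-- The product of all terms of the first split sequence. -/
noncomputable def firstSplitProd {K 𝒜 : Type*} [Field K] [Ring 𝒜] [Algebra K 𝒜] {d : ℕ}
    (e : 𝒜 ≃ₐ[K] Matrix (Fin (d + 1)) (Fin (d + 1)) K) (Φ : LeonardSystem K 𝒜 d) : K :=
  ∏ i : Fin d, firstSplit e Φ i

/-- `σ` is the antiautomorphism of `𝒜` that fixes `A` and `A^*`. -/
def IsDagger {K 𝒜 : Type*} [Field K] [Ring 𝒜] [Algebra K 𝒜] {d : ℕ}
    (Φ : LeonardSystem K 𝒜 d) (σ : 𝒜 ≃ₐ[K] 𝒜ᵐᵒᵖ) : Prop :=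
  (σ Φ.A).unop = Φ.A ∧ (σ Φ.As).unop = Φ.As

/-- `X` is one of `{E_i}`, `{E_{d-i}}`, `{τ_i(A)}`, `{τ_{d-i}(A)}`, `{η_i(A)}`, `{η_{d-i}(A)}`. -/
def IsSeq {K 𝒜 : Type*} [Field K] [Ring 𝒜] [Algebra K 𝒜] {d : ℕ}
    (Φ : LeonardSystem K 𝒜 d) (X : Fin (d + 1) → 𝒜) : Prop :=
  (X = fun i => Φ.E i) ∨
  (X = fun i => Φ.E i.rev) ∨
  (X = fun i => aeval Φ.A (tauPoly Φ.θ i.val)) ∨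
  (X = fun i => aeval Φ.A (tauPoly Φ.θ (d - i.val))) ∨
  (X = fun i => aeval Φ.A (etaPoly Φ.θ i.val)) ∨
  (X = fun i => aeval Φ.A (etaPoly Φ.θ (d - i.val)))

/-- `X` is one of `{E^*_i}`, `{E^*_{d-i}}`, `{τ^*_i(A^*)}`, `{τ^*_{d-i}(A^*)}`, `{η^*_i(A^*)}`,
`{η^*_{d-i}(A^*)}`. -/
def IsDualSeq {K 𝒜 : Type*} [Field K] [Ring 𝒜] [Algebra K 𝒜] {d : ℕ}
    (Φ : LeonardSystem K 𝒜 d) (X : Fin (d + 1) → 𝒜) : Prop :=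
  (X = fun i => Φ.Es i) ∨
  (X = fun i => Φ.Es i.rev) ∨
  (X = fun i => aeval Φ.As (tauPoly Φ.θs i.val)) ∨
  (X = fun i => aeval Φ.As (tauPoly Φ.θs (d - i.val))) ∨
  (X = fun i => aeval Φ.As (etaPoly Φ.θs i.val)) ∨
  (X = fun i => aeval Φ.As (etaPoly Φ.θs (d - i.val)))

end LeonardSystem

/-- `B` is a bilinear form on `V` associated with the antiautomorphism `σ`: it is nonzero and
`B (X u) v = B u (X^σ v)`. -/
def IsAssociatedForm {K 𝒜 V : Type*} [Field K] [Ring 𝒜] [Algebra K 𝒜]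
    [AddCommGroup V] [Module K V] [Module 𝒜 V] (σ : 𝒜 ≃ₐ[K] 𝒜ᵐᵒᵖ)
    (B : LinearMap.BilinForm K V) : Prop :=
  B ≠ 0 ∧ ∀ (X : 𝒜) (u v : V), B (X • u) v = B u ((σ X).unop • v)

/-!
Everything takes place in `𝒜`, where the idempotents `E_i` and `E^*_i` correspond to rank-one
matrices (`IsPrimitiveIdempotents.exists_dual_bases`). For a rank-one `P` one has
`P Y P = tr(Y P) P` (`IsRankOne.mul_mul_self`), and `X P ≠ 0`, `P Z ≠ 0` imply `X P Z ≠ 0`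
(`IsRankOne.mul_mul_ne_zero`).

In each sum, multiplication by `E_i` isolates the term `r = i`, so the shape of the sequence `X` is
immaterial: it suffices to see how `E^*_d E_i` and `E^*_0 E_i` act on `ξ^*_d`. Since `ξ^*_d` is
fixed by `E^*_d`, the former acts as the scalar `tr(E_i E^*_d)`, and `E_0`, `E_d` then map `ξ^*_d`
to multiples of `ξ_0`, `ξ_d` which the bilinear form computes. For the latter,
`τ_i(θ_i) η_{d-i}(θ_i) E_i = ∏_{j ≠ i} (A - θ_j)` is monic of degree `d` in `A`, and `A` is
tridiagonal with respect to the `E^*_j`, so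
`τ_i(θ_i) η_{d-i}(θ_i) E^*_0 E_i E^*_d = E^*_0 A ^ d E^*_d` does not depend on `i`
(`LeonardSystem.prod_sub_smul_corner`). The common scalar is found at `i = d` by pairing with
`ξ_d`, using `φ = η^*_d(θ^*_0) tr(τ_d(A) E^*_0)` (`LeonardSystem.firstSplitProd_eq`).

The denominators are nonzero because a nonzero solution of an irreducible three-term recurrence does
not vanish at an end of the chain (`IsTridiagonal.mul_zero_ne_zero`), and because for a suitable `q`
of degree `i` the element `E_0 q(A^*) τ_i(A) E^*_0` is nonzero and at the same time a scalar multiple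
of `tr(τ_i(A) E^*_0) E_0 E^*_0` (`LeonardSystem.splitTrace_ne_zero`).
-/

/-! ### Rank-one elements -/

/-- `P` corresponds under `e` to a matrix `v wᵀ` of rank at most one. -/
def IsRankOne {K 𝒜 : Type*} [Field K] [Ring 𝒜] [Algebra K 𝒜] {d : ℕ}
    (e : 𝒜 ≃ₐ[K] Matrix (Fin (d + 1)) (Fin (d + 1)) K) (P : 𝒜) : Prop :=
  ∃ v w : Fin (d + 1) → K, e P = Matrix.vecMulVec v w

section RankOne

variable {K 𝒜 : Type*} [Field K] [Ring 𝒜] [Algebra K 𝒜] {d : ℕ}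
  {e : 𝒜 ≃ₐ[K] Matrix (Fin (d + 1)) (Fin (d + 1)) K}

theorem IsRankOne.mul_mul_self {P : 𝒜} (hP : IsRankOne e P) (Y : 𝒜) :
    P * Y * P = algTrace e (Y * P) • P := by
  obtain ⟨v, w, h⟩ := hP
  apply e.injective
  simp only [map_mul, map_smul, algTrace, h]
  rw [Matrix.vecMulVec_mul, Matrix.vecMulVec_mul_vecMulVec, Matrix.mul_vecMulVec,
    Matrix.trace_vecMulVec, ← Matrix.dotProduct_mulVec, dotProduct_comm w, Matrix.vecMulVec_smul]

theorem IsRankOne.mul_mul_ne_zero {P : 𝒜} (hP : IsRankOne e P) {X Z : 𝒜}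
    (hX : X * P ≠ 0) (hZ : P * Z ≠ 0) : X * P * Z ≠ 0 := by
  obtain ⟨v, w, h⟩ := hP
  rw [← (map_ne_zero_iff e e.injective)] at hX hZ ⊢
  simp only [map_mul, h, Matrix.mul_vecMulVec, Matrix.vecMulVec_mul, ne_eq,
    Matrix.vecMulVec_eq_zero, not_or] at hX hZ ⊢
  exact ⟨hX.1, hZ.2⟩

/-- The corner `P 𝒜 Q` of two rank-one elements is at most one-dimensional. -/
theorem IsRankOne.exists_mul_mul_eq_smul {P Q : 𝒜} (hP : IsRankOne e P) (hQ : IsRankOne e Q)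
    (hPQ : P * Q ≠ 0) (W : 𝒜) : ∃ c : K, P * W * Q = c • (P * Q) := by
  obtain ⟨v, w, h⟩ := hP
  obtain ⟨v', w', h'⟩ := hQ
  have h1 : e (P * W * Q) = (w ⬝ᵥ (e W).mulVec v') • Matrix.vecMulVec v w' := by
    rw [map_mul, map_mul, h, h', Matrix.vecMulVec_mul, Matrix.vecMulVec_mul_vecMulVec,
      Matrix.dotProduct_mulVec, Matrix.vecMulVec_smul]
  have h2 : e (P * Q) = (w ⬝ᵥ v') • Matrix.vecMulVec v w' := by
    rw [map_mul, h, h', Matrix.vecMulVec_mul_vecMulVec, Matrix.vecMulVec_smul]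
  have h3 : w ⬝ᵥ v' ≠ 0 := by
    intro h0
    rw [h0, zero_smul] at h2
    exact hPQ (e.injective (h2.trans (map_zero e).symm))
  refine ⟨(w ⬝ᵥ (e W).mulVec v') / (w ⬝ᵥ v'), e.injective ?_⟩
  rw [map_smul, h1, h2, smul_smul, div_mul_cancel₀ _ h3]

/-- For rank-one `P`, `Q` the trace of `P Q` is the product of the two scalars that measure
`P Q` and `Q P`. -/
theorem IsRankOne.algTrace_mul_ne_zero {P Q : 𝒜} (hP : IsRankOne e P) (hQ : IsRankOne e Q)
    (hPQ : P * Q ≠ 0) (hQP : Q * P ≠ 0) : algTrace e (P * Q) ≠ 0 := by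
  intro h
  have h1 := hQ.mul_mul_self P
  rw [h, zero_smul] at h1
  exact hP.mul_mul_ne_zero hQP hPQ h1

end RankOne

/-! ### Primitive idempotents -/

namespace IsPrimitiveIdempotents

variable {K 𝒜 : Type*} [Field K] [Ring 𝒜] [Algebra K 𝒜] {d : ℕ}
  {A : 𝒜} {θ : Fin (d + 1) → K} {E : Fin (d + 1) → 𝒜}

theorem sum_eq_one (h : IsPrimitiveIdempotents A θ E) : ∑ i, E i = 1 := by
  simp only [h.eq_aeval]
  rw [← map_sum, Lagrange.sum_basis h.injective.injOn Finset.univ_nonempty, map_one]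

/-- Diagonalization of `A`: the `v i` are eigenvectors, and the `w i` the dual basis. -/
theorem exists_dual_bases (h : IsPrimitiveIdempotents A θ E)
    (e : 𝒜 ≃ₐ[K] Matrix (Fin (d + 1)) (Fin (d + 1)) K) :
    ∃ v w : Fin (d + 1) → Fin (d + 1) → K,
      (∀ i, e (E i) = Matrix.vecMulVec (v i) (w i)) ∧
      (∀ i j, w i ⬝ᵥ v j = if i = j then 1 else 0) ∧
      ∀ i, (e A).mulVec (v i) = θ i • v i := by
  have hv : ∀ i, ∃ x, Module.End.HasEigenvector (Matrix.toLin' (e A)) (θ i) x := by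
    intro i
    apply Module.End.HasEigenvalue.exists_hasEigenvector
    rw [Module.End.hasEigenvalue_iff_mem_spectrum, Matrix.spectrum_toLin', AlgEquiv.spectrum_eq]
    exact h.mem_spectrum i
  choose v hv using hv
  have hli : LinearIndependent K v :=
    Module.End.eigenvectors_linearIndependent' _ θ h.injective v hv
  let P : Matrix (Fin (d + 1)) (Fin (d + 1)) K := Matrix.of fun k j => v j k
  have hP : IsUnit P := Matrix.linearIndependent_cols_iff_isUnit.mp hli
  have hdet : IsUnit P.det := (Matrix.isUnit_iff_isUnit_det P).mp hP
  have hsum : ∑ j, Matrix.vecMulVec (v j) (P⁻¹ j) = 1 := by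
    rw [← Matrix.mul_nonsing_inv P hdet]
    ext a b
    simp [Matrix.sum_apply, Matrix.vecMulVec_apply, Matrix.mul_apply, P]
  refine ⟨v, fun i => P⁻¹ i, fun i => ?_, fun i j => ?_, fun i => ?_⟩
  · have hE : ∀ j, (e (E i)).mulVec (v j) = (if j = i then (1 : K) else 0) • v j := by
      intro j
      have h1 := Module.End.aeval_apply_of_hasEigenvector
        (p := Lagrange.basis Finset.univ θ i) (hv j)
      rw [h.eq_aeval, ← Polynomial.aeval_algHom_apply e A]
      have h2 : (aeval (Matrix.toLin' (e A))) (Lagrange.basis Finset.univ θ i)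
          = Matrix.toLin' (aeval (e A) (Lagrange.basis Finset.univ θ i)) :=
        Polynomial.aeval_algHom_apply (Matrix.toLinAlgEquiv' (R := K)) (e A) _
      rw [h2, Matrix.toLin'_apply] at h1
      rw [h1]
      split_ifs with hj
      · rw [hj, Lagrange.eval_basis_self h.injective.injOn (Finset.mem_univ _)]
      · rw [Lagrange.eval_basis_of_ne (Ne.symm hj) (Finset.mem_univ _)]
    rw [← mul_one (e (E i)), ← hsum, Finset.mul_sum]
    simp only [Matrix.mul_vecMulVec, hE]
    rw [Finset.sum_eq_single i]
    · simp
    · intro j _ hj; simp [hj]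
    · simp
  · have := congrFun (congrFun (Matrix.nonsing_inv_mul P hdet) i) j
    rw [Matrix.one_apply] at this
    rw [← this]
    rfl
  · simpa using (hv i).apply_eq_smul

theorem isRankOne (h : IsPrimitiveIdempotents A θ E)
    (e : 𝒜 ≃ₐ[K] Matrix (Fin (d + 1)) (Fin (d + 1)) K) (i : Fin (d + 1)) :
    IsRankOne e (E i) := by
  obtain ⟨v, w, h1, -⟩ := h.exists_dual_bases e
  exact ⟨_, _, h1 i⟩

theorem algTrace_eq_one (h : IsPrimitiveIdempotents A θ E)
    (e : 𝒜 ≃ₐ[K] Matrix (Fin (d + 1)) (Fin (d + 1)) K) (i : Fin (d + 1)) :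
    algTrace e (E i) = 1 := by
  obtain ⟨v, w, h1, h2, -⟩ := h.exists_dual_bases e
  rw [algTrace, h1, Matrix.trace_vecMulVec, dotProduct_comm, h2, if_pos rfl]

theorem mul_eq (h : IsPrimitiveIdempotents A θ E)
    (e : 𝒜 ≃ₐ[K] Matrix (Fin (d + 1)) (Fin (d + 1)) K) (i j : Fin (d + 1)) :
    E i * E j = if i = j then E i else 0 := by
  obtain ⟨v, w, h1, h2, -⟩ := h.exists_dual_bases e
  apply e.injective
  rw [map_mul, h1, h1, Matrix.vecMulVec_mul_vecMulVec, h2]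
  split_ifs with hij
  · simp [hij, h1]
  · simp

theorem ne_zero (h : IsPrimitiveIdempotents A θ E)
    (e : 𝒜 ≃ₐ[K] Matrix (Fin (d + 1)) (Fin (d + 1)) K) (i : Fin (d + 1)) : E i ≠ 0 := by
  intro h0
  have := h.algTrace_eq_one e i
  simp [h0, algTrace] at this

theorem aeval_mul (h : IsPrimitiveIdempotents A θ E)
    (e : 𝒜 ≃ₐ[K] Matrix (Fin (d + 1)) (Fin (d + 1)) K) (p : K[X]) (i : Fin (d + 1)) :
    aeval A p * E i = p.eval (θ i) • E i := by
  have hA : A * E i = θ i • E i := by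
    obtain ⟨v, w, h1, -, h3⟩ := h.exists_dual_bases e
    apply e.injective
    rw [map_mul, map_smul, h1, Matrix.mul_vecMulVec, h3, Matrix.smul_vecMulVec]
  induction p using Polynomial.induction_on' with
  | add p q hp hq => rw [map_add, add_mul, hp, hq, eval_add, add_smul]
  | monomial n a =>
    rw [aeval_monomial, eval_monomial, ← Algebra.smul_def, smul_mul_assoc, mul_smul]
    congr 1
    induction n with
    | zero => simp
    | succ n ih => rw [pow_succ, mul_assoc, hA, mul_smul_comm, ih, smul_smul, pow_succ, mul_comm]

theorem mul_aeval (h : IsPrimitiveIdempotents A θ E)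
    (e : 𝒜 ≃ₐ[K] Matrix (Fin (d + 1)) (Fin (d + 1)) K) (p : K[X]) (i : Fin (d + 1)) :
    E i * aeval A p = p.eval (θ i) • E i := by
  rw [← h.aeval_mul e, h.eq_aeval, ← map_mul, ← map_mul, mul_comm]

/-- Clearing the denominators in the Lagrange polynomial. -/
theorem prod_sub_smul (h : IsPrimitiveIdempotents A θ E) (i : Fin (d + 1)) :
    (∏ j ∈ Finset.univ.erase i, (θ i - θ j)) • E i =
      aeval A (∏ j ∈ Finset.univ.erase i, (X - C (θ j))) := by
  rw [h.eq_aeval, ← map_smul]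
  congr 1
  simp only [Lagrange.basis, Lagrange.basisDivisor]
  rw [Finset.prod_mul_distrib, ← map_prod, smul_eq_C_mul, ← mul_assoc, ← C_mul,
    ← Finset.prod_mul_distrib, Finset.prod_eq_one, C_1, one_mul]
  intro j hj
  exact mul_inv_cancel₀ (sub_ne_zero.mpr fun hij =>
    (Finset.mem_erase.mp hj).1 (h.injective hij).symm)

end IsPrimitiveIdempotents

/-! ### Irreducible tridiagonal elements -/

/-- `B` is irreducible tridiagonal with respect to the complete system `F` of orthogonal rank-one
idempotents: `F i * B * F j` vanishes if `|i - j| > 1` and does not if `|i - j| = 1`. -/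
structure IsTridiagonal {K 𝒜 : Type*} [Field K] [Ring 𝒜] [Algebra K 𝒜] {d : ℕ}
    (e : 𝒜 ≃ₐ[K] Matrix (Fin (d + 1)) (Fin (d + 1)) K) (F : Fin (d + 1) → 𝒜) (B : 𝒜) : Prop where
  isRankOne : ∀ i, IsRankOne e (F i)
  ne_zero : ∀ i, F i ≠ 0
  sum_eq_one : ∑ i, F i = 1
  mul_eq : ∀ i j, F i * F j = if i = j then F i else 0
  eq_zero : ∀ i j : Fin (d + 1), 1 < |(i.val : ℤ) - (j.val : ℤ)| → F i * B * F j = 0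
  mul_mul_ne_zero : ∀ i j : Fin (d + 1), |(i.val : ℤ) - (j.val : ℤ)| = 1 → F i * B * F j ≠ 0

namespace IsTridiagonal

variable {K 𝒜 : Type*} [Field K] [Ring 𝒜] [Algebra K 𝒜] {d : ℕ}
  {e : 𝒜 ≃ₐ[K] Matrix (Fin (d + 1)) (Fin (d + 1)) K} {F : Fin (d + 1) → 𝒜} {B : 𝒜}

theorem rev (h : IsTridiagonal e F B) : IsTridiagonal e (fun i => F i.rev) B where
  isRankOne i := h.isRankOne _
  ne_zero i := h.ne_zero _
  sum_eq_one := by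
    rw [← h.sum_eq_one]
    exact Equiv.sum_comp Fin.revPerm F
  mul_eq i j := by simp [h.mul_eq]
  eq_zero i j hij := by
    apply h.eq_zero
    rw [Fin.val_rev, Fin.val_rev]
    simp only [abs_eq_max_neg] at hij ⊢
    omega
  mul_mul_ne_zero i j hij := by
    apply h.mul_mul_ne_zero
    rw [Fin.val_rev, Fin.val_rev]
    simp only [abs_eq_max_neg] at hij ⊢
    omega

/-- Insertion of `1 = ∑ m, F m` into a product. -/
theorem mul_eq_sum (h : IsTridiagonal e F B) (Y Z : 𝒜) : Y * Z = ∑ m, Y * F m * Z := by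
  rw [← Finset.sum_mul, ← Finset.mul_sum, h.sum_eq_one, mul_one]

theorem mul_pow_mul_eq_zero (h : IsTridiagonal e F B) (k : ℕ) (i j : Fin (d + 1))
    (hk : (k : ℤ) < |(i.val : ℤ) - (j.val : ℤ)|) : F i * B ^ k * F j = 0 := by
  induction k generalizing j with
  | zero =>
    rw [pow_zero, mul_one, h.mul_eq, if_neg]
    rintro rfl
    simp at hk
  | succ k ih =>
    rw [pow_succ, ← mul_assoc, mul_assoc, h.mul_eq_sum]
    refine Finset.sum_eq_zero fun m _ => ?_
    by_cases hm : (k : ℤ) < |(i.val : ℤ) - (m.val : ℤ)|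
    · rw [ih m hm, zero_mul]
    · have : 1 < |(m.val : ℤ) - (j.val : ℤ)| := by
        simp only [abs_eq_max_neg] at hk hm ⊢
        omega
      rw [mul_assoc, ← mul_assoc (F m), h.eq_zero m j this, mul_zero]

theorem mul_pow_mul_ne_zero (h : IsTridiagonal e F B) (k : ℕ) (i j : Fin (d + 1))
    (hk : |(i.val : ℤ) - (j.val : ℤ)| = k) : F i * B ^ k * F j ≠ 0 := by
  induction k generalizing j with
  | zero =>
    obtain rfl : i = j := Fin.ext (by simp only [abs_eq_max_neg] at hk; omega)
    rw [pow_zero, mul_one, h.mul_eq, if_pos rfl]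
    exact h.ne_zero i
  | succ k ih =>
    -- only the neighbour `m` of `j` on the side of `i` contributes
    obtain ⟨m, hm, hmj⟩ : ∃ m : Fin (d + 1), |(i.val : ℤ) - (m.val : ℤ)| = k ∧
        |(m.val : ℤ) - (j.val : ℤ)| = 1 := by
      simp only [abs_eq_max_neg] at hk ⊢
      rcases lt_or_ge i.val j.val with hij | hij
      · exact ⟨⟨j.val - 1, by omega⟩, by simp only; omega, by simp only; omega⟩
      · exact ⟨⟨j.val + 1, by omega⟩, by simp only; omega, by simp only; omega⟩
    rw [pow_succ, ← mul_assoc, mul_assoc, h.mul_eq_sum, Finset.sum_eq_single m]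
    · apply (h.isRankOne m).mul_mul_ne_zero (ih m hm)
      rw [← mul_assoc]
      exact h.mul_mul_ne_zero m j hmj
    · intro b _ hb
      by_cases hbi : (k : ℤ) < |(i.val : ℤ) - (b.val : ℤ)|
      · rw [h.mul_pow_mul_eq_zero k i b hbi, zero_mul]
      · have : 1 < |(b.val : ℤ) - (j.val : ℤ)| := by
          have hb' : b.val ≠ m.val := fun hh => hb (Fin.ext hh)
          simp only [abs_eq_max_neg] at hk hm hmj hbi ⊢
          omega
        rw [mul_assoc, ← mul_assoc (F b), h.eq_zero b j this, mul_zero]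
    · simp

theorem mul_aeval_mul_eq_zero (h : IsTridiagonal e F B) (p : K[X]) (i j : Fin (d + 1))
    (hp : (p.natDegree : ℤ) < |(i.val : ℤ) - (j.val : ℤ)|) : F i * aeval B p * F j = 0 := by
  rw [aeval_eq_sum_range, Finset.mul_sum, Finset.sum_mul]
  refine Finset.sum_eq_zero fun k hk => ?_
  rw [Finset.mem_range] at hk
  rw [mul_smul_comm, smul_mul_assoc, h.mul_pow_mul_eq_zero k i j (by omega), smul_zero]

/-- Only the leading term of `p` matters for `F i * p(B) * F j` when `p` has degree `|i - j|`. -/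
theorem mul_aeval_mul_eq_pow (h : IsTridiagonal e F B) {p : K[X]} (hp : p.Monic)
    (i j : Fin (d + 1)) (hd : |(i.val : ℤ) - (j.val : ℤ)| = p.natDegree) :
    F i * aeval B p * F j = F i * B ^ p.natDegree * F j := by
  rw [aeval_eq_sum_range, Finset.mul_sum, Finset.sum_mul, Finset.sum_range_succ,
    Finset.sum_eq_zero, zero_add, hp.coeff_natDegree, one_smul]
  intro k hk
  rw [Finset.mem_range] at hk
  rw [mul_smul_comm, smul_mul_assoc, h.mul_pow_mul_eq_zero k i j (by omega), smul_zero]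

/-- A left eigenvector of `B` has a nonzero component at the end `F 0` of the tridiagonal chain:
by the three-term recurrence, a zero there would propagate along the chain. -/
theorem mul_zero_ne_zero (h : IsTridiagonal e F B) {Y : 𝒜} (hY : Y ≠ 0) {c : K}
    (hYB : Y * B = c • Y) : Y * F 0 ≠ 0 := by
  intro h0
  have hpow : ∀ k : ℕ, Y * B ^ k = c ^ k • Y := by
    intro k
    induction k with
    | zero => simp
    | succ k ih => rw [pow_succ, ← mul_assoc, ih, smul_mul_assoc, hYB, smul_smul, pow_succ]
  have key : ∀ (n : ℕ) (k : Fin (d + 1)), k.val = n → Y * F k = 0 := by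
    intro n
    induction n using Nat.strong_induction_on with
    | _ n ih =>
      intro k hk
      by_contra hne
      have h1 : Y * F k * (B ^ n * F 0) = 0 := by
        have h2 : Y * B ^ n * F 0 = 0 := by rw [hpow, smul_mul_assoc, h0, smul_zero]
        rw [mul_assoc, h.mul_eq_sum, Finset.sum_eq_single k] at h2
        · exact h2
        · intro m _ hm
          rcases lt_or_ge m.val n with hmn | hmn
          · rw [ih m.val hmn m rfl, zero_mul]
          · have : (n : ℤ) < |(m.val : ℤ) - ((0 : Fin (d + 1)).val : ℤ)| := by
              have : m.val ≠ k.val := fun hh => hm (Fin.ext hh)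
              rw [Fin.val_zero, abs_eq_max_neg]
              omega
            rw [mul_assoc, ← mul_assoc (F m), h.mul_pow_mul_eq_zero n m 0 this, mul_zero]
        · simp
      refine (h.isRankOne k).mul_mul_ne_zero hne ?_ h1
      rw [← mul_assoc]
      apply h.mul_pow_mul_ne_zero
      rw [Fin.val_zero, abs_eq_max_neg]
      omega
  apply hY
  rw [← mul_one Y, ← h.sum_eq_one, Finset.mul_sum]
  exact Finset.sum_eq_zero fun k _ => key _ k rfl

theorem mul_last_ne_zero (h : IsTridiagonal e F B) {Y : 𝒜} (hY : Y ≠ 0) {c : K}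
    (hYB : Y * B = c • Y) : Y * F (Fin.last d) ≠ 0 := by
  simpa using h.rev.mul_zero_ne_zero hY hYB

end IsTridiagonal

/-! ### The polynomials `τ` and `η` -/

section Polynomials

variable {K : Type*} [Field K] {d : ℕ}

theorem tauPoly_eq_prod_Iio (θ : Fin (d + 1) → K) (i : Fin (d + 1)) :
    tauPoly θ i = ∏ h ∈ Finset.Iio i, (X - C (θ h)) := by
  rw [tauPoly]
  congr 1
  ext h
  simp [← Fin.val_fin_lt]

theorem natDegree_tauPoly (θ : Fin (d + 1) → K) (i : Fin (d + 1)) :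
    (tauPoly θ i).natDegree = i := by
  rw [tauPoly_eq_prod_Iio, natDegree_finsetProd_X_sub_C_eq_card, Fin.card_Iio]

theorem eval_tauPoly_mul_eval_etaPoly (θ : Fin (d + 1) → K) (r : Fin (d + 1)) (x : K) :
    (tauPoly θ r).eval x * (etaPoly θ (d - r)).eval x =
      ∏ j ∈ Finset.univ.erase r, (x - θ j) := by
  rw [tauPoly, etaPoly, eval_prod, eval_prod, ← Finset.prod_union]
  · simp only [eval_sub, eval_X, eval_C]
    congr 1
    ext h
    simp only [Finset.mem_union, Finset.mem_filter, Finset.mem_univ, true_and, Finset.mem_erase,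
      and_true, ne_eq, Fin.ext_iff]
    omega
  · rw [Finset.disjoint_filter]
    intro h _
    omega

theorem tauPoly_last (θ : Fin (d + 1) → K) :
    tauPoly θ d = ∏ j ∈ Finset.univ.erase (Fin.last d), (X - C (θ j)) := by
  rw [tauPoly]
  congr 1
  ext h
  simp only [Finset.mem_filter, Finset.mem_univ, true_and, Finset.mem_erase, and_true, ne_eq,
    Fin.ext_iff, Fin.val_last]
  omega

theorem eval_etaPoly_diameter (θ : Fin (d + 1) → K) (x : K) :
    (etaPoly θ d).eval x = ∏ i : Fin d, (x - θ i.succ) := by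
  rw [etaPoly, eval_prod, Finset.prod_filter, Fin.prod_univ_succ]
  simp

end Polynomials

/-! ### Leonard systems -/

namespace LeonardSystem

variable {K 𝒜 : Type*} [Field K] [Ring 𝒜] [Algebra K 𝒜] {d : ℕ}
  (Φ : LeonardSystem K 𝒜 d) (e : 𝒜 ≃ₐ[K] Matrix (Fin (d + 1)) (Fin (d + 1)) K)

theorem isTridiagonal : IsTridiagonal e Φ.E Φ.As where
  isRankOne := Φ.idem.isRankOne e
  ne_zero := Φ.idem.ne_zero e
  sum_eq_one := Φ.idem.sum_eq_one
  mul_eq := Φ.idem.mul_eq e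
  eq_zero := Φ.E_As_E_zero
  mul_mul_ne_zero := Φ.E_As_E_ne

theorem isTridiagonal_dual : IsTridiagonal e Φ.Es Φ.A where
  isRankOne := Φ.idem_s.isRankOne e
  ne_zero := Φ.idem_s.ne_zero e
  sum_eq_one := Φ.idem_s.sum_eq_one
  mul_eq := Φ.idem_s.mul_eq e
  eq_zero := Φ.Es_A_Es_zero
  mul_mul_ne_zero := Φ.Es_A_Es_ne

theorem E_mul_A (e : 𝒜 ≃ₐ[K] Matrix (Fin (d + 1)) (Fin (d + 1)) K)
    (i : Fin (d + 1)) : Φ.E i * Φ.A = Φ.θ i • Φ.E i := by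
  simpa using Φ.idem.mul_aeval e X i

theorem E_mul_Es_zero_ne_zero (e : 𝒜 ≃ₐ[K] Matrix (Fin (d + 1)) (Fin (d + 1)) K)
    (i : Fin (d + 1)) : Φ.E i * Φ.Es 0 ≠ 0 :=
  (Φ.isTridiagonal_dual e).mul_zero_ne_zero (Φ.idem.ne_zero e i) (Φ.E_mul_A e i)

theorem E_mul_Es_last_ne_zero (e : 𝒜 ≃ₐ[K] Matrix (Fin (d + 1)) (Fin (d + 1)) K)
    (i : Fin (d + 1)) : Φ.E i * Φ.Es (Fin.last d) ≠ 0 :=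
  (Φ.isTridiagonal_dual e).mul_last_ne_zero (Φ.idem.ne_zero e i) (Φ.E_mul_A e i)

/-- With `q = (λ - θ^*_1) ⋯ (λ - θ^*_i)`, the product `E_0 q(A^*) τ_i(A) E^*_0` is nonzero, since
inserting `1 = ∑ E_j` in the middle leaves only the term `j = i`; inserting `1 = ∑ E^*_j`
instead leaves only `j = 0`, a multiple of `tr(τ_i(A) E^*_0)`. -/
theorem splitTrace_ne_zero (i : Fin (d + 1)) : Φ.splitTrace e i ≠ 0 := by
  intro h0
  set q : K[X] := ∏ h ∈ Finset.Ioc 0 i, (X - C (Φ.θs h)) with hq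
  have hqdeg : q.natDegree = i := by
    rw [hq, natDegree_finsetProd_X_sub_C_eq_card, Fin.card_Ioc, Fin.val_zero, Nat.sub_zero]
  have hqmonic : q.Monic := monic_prod_of_monic _ _ fun h _ => monic_X_sub_C _
  have h1 : aeval Φ.As q * (aeval Φ.A (tauPoly Φ.θ i) * Φ.Es 0) = 0 := by
    rw [(Φ.isTridiagonal_dual e).mul_eq_sum]
    refine Finset.sum_eq_zero fun j _ => ?_
    rw [Φ.idem_s.aeval_mul e, smul_mul_assoc, ← mul_assoc]
    rcases eq_or_ne j 0 with rfl | hj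
    · rw [(Φ.idem_s.isRankOne e 0).mul_mul_self]
      change _ • Φ.splitTrace e i • _ = _
      rw [h0, zero_smul, smul_zero]
    · rcases le_or_gt j i with hji | hji
      · rw [hq, eval_prod, Finset.prod_eq_zero (i := j), zero_smul]
        · exact Finset.mem_Ioc.mpr ⟨Fin.pos_iff_ne_zero.mpr hj, hji⟩
        · simp
      · rw [(Φ.isTridiagonal_dual e).mul_aeval_mul_eq_zero, smul_zero]
        rw [natDegree_tauPoly, Fin.val_zero, abs_eq_max_neg]
        rw [Fin.lt_def] at hji
        omega
  have h2 : Φ.E 0 * aeval Φ.As q * (aeval Φ.A (tauPoly Φ.θ i) * Φ.Es 0) =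
      (tauPoly Φ.θ i).eval (Φ.θ i) • (Φ.E 0 * aeval Φ.As q * Φ.E i * Φ.Es 0) := by
    rw [(Φ.isTridiagonal e).mul_eq_sum, Finset.sum_eq_single i]
    · rw [mul_assoc, ← mul_assoc (Φ.E i), Φ.idem.mul_aeval e, smul_mul_assoc, mul_smul_comm,
        ← mul_assoc]
    · intro j _ hj
      rcases lt_or_gt_of_ne hj with hji | hji
      · rw [mul_assoc, ← mul_assoc (Φ.E j), Φ.idem.mul_aeval e, tauPoly_eq_prod_Iio, eval_prod,
          Finset.prod_eq_zero (Finset.mem_Iio.mpr hji) (by simp), zero_smul, zero_mul, mul_zero]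
      · rw [(Φ.isTridiagonal e).mul_aeval_mul_eq_zero, zero_mul]
        rw [hqdeg, Fin.val_zero, abs_eq_max_neg]
        rw [Fin.lt_def] at hji
        omega
    · simp
  rw [mul_assoc, h1, mul_zero] at h2
  refine smul_ne_zero ?_ ?_ h2.symm
  · rw [tauPoly_eq_prod_Iio, eval_prod, Finset.prod_ne_zero_iff]
    intro j hj
    rw [eval_sub, eval_X, eval_C, sub_ne_zero]
    exact fun hij => (Finset.mem_Iio.mp hj).ne (Φ.idem.injective hij).symm
  · apply (Φ.idem.isRankOne e i).mul_mul_ne_zero _ (Φ.E_mul_Es_zero_ne_zero e i)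
    have hdist : |((0 : Fin (d + 1)).val : ℤ) - (i.val : ℤ)| = q.natDegree := by
      rw [hqdeg, Fin.val_zero, abs_eq_max_neg]
      omega
    rw [(Φ.isTridiagonal e).mul_aeval_mul_eq_pow hqmonic _ _ hdist]
    exact (Φ.isTridiagonal e).mul_pow_mul_ne_zero _ _ _ hdist

/-- The quotients in the definition of the split sequence telescope. -/
theorem firstSplitProd_eq :
    Φ.firstSplitProd e = (etaPoly Φ.θs d).eval (Φ.θs 0) * Φ.splitTrace e d := by
  have hs : ∀ n ≤ d, Φ.splitTrace e n ≠ 0 := fun n hn =>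
    Φ.splitTrace_ne_zero e ⟨n, Nat.lt_succ_of_le hn⟩
  have h0 : Φ.splitTrace e 0 = 1 := by
    simp [splitTrace, tauPoly, Φ.idem_s.algTrace_eq_one e]
  have htel : ∀ n ≤ d, ∏ i ∈ Finset.range n, Φ.splitTrace e (i + 1) / Φ.splitTrace e i =
      Φ.splitTrace e n := by
    intro n
    induction n with
    | zero => simp [h0]
    | succ n ih =>
      intro hn
      rw [Finset.prod_range_succ, ih (by omega), mul_div_cancel₀ _ (hs n (by omega))]
  rw [firstSplitProd, eval_etaPoly_diameter]
  simp only [firstSplit]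
  rw [Finset.prod_mul_distrib,
    Fin.prod_univ_eq_prod_range (fun i => Φ.splitTrace e (i + 1) / Φ.splitTrace e i) d,
    htel d le_rfl]

theorem eval_etaPoly_dual_ne_zero : (etaPoly Φ.θs d).eval (Φ.θs 0) ≠ 0 := by
  rw [eval_etaPoly_diameter, Finset.prod_ne_zero_iff]
  intro i _
  rw [sub_ne_zero]
  exact fun h => (Fin.succ_ne_zero i) (Φ.idem_s.injective h).symm

theorem splitTrace_diameter :
    Φ.splitTrace e d = (∏ j ∈ Finset.univ.erase (Fin.last d), (Φ.θ (Fin.last d) - Φ.θ j)) *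
      algTrace e (Φ.E (Fin.last d) * Φ.Es 0) := by
  rw [splitTrace, tauPoly_last, ← Φ.idem.prod_sub_smul, smul_mul_assoc, algTrace, map_smul,
    Matrix.trace_smul, smul_eq_mul, algTrace]

/-- `∏_{j ≠ i} (A - θ_j)` is monic of degree `d`, so its corner between `E^*_0` and `E^*_d` is that
of `A ^ d`. -/
theorem prod_sub_smul_corner (e : 𝒜 ≃ₐ[K] Matrix (Fin (d + 1)) (Fin (d + 1)) K)
    (i : Fin (d + 1)) :
    (∏ j ∈ Finset.univ.erase i, (Φ.θ i - Φ.θ j)) • (Φ.Es 0 * Φ.E i * Φ.Es (Fin.last d)) =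
      Φ.Es 0 * Φ.A ^ d * Φ.Es (Fin.last d) := by
  have hdeg : (∏ j ∈ Finset.univ.erase i, (X - C (Φ.θ j))).natDegree = d := by
    rw [natDegree_finsetProd_X_sub_C_eq_card, Finset.card_erase_of_mem (Finset.mem_univ _),
      Finset.card_univ, Fintype.card_fin, Nat.add_sub_cancel]
  have := (Φ.isTridiagonal_dual e).mul_aeval_mul_eq_pow
    (monic_prod_of_monic (Finset.univ.erase i) (fun j => X - C (Φ.θ j))
      fun j _ => monic_X_sub_C _) 0 (Fin.last d) (by rw [hdeg]; simp)
  rw [hdeg, ← Φ.idem.prod_sub_smul, mul_smul_comm, smul_mul_assoc] at this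
  exact this

theorem sum_smul_mul_mul (e : 𝒜 ≃ₐ[K] Matrix (Fin (d + 1)) (Fin (d + 1)) K)
    (c : Fin (d + 1) → K) (Y : Fin (d + 1) → 𝒜) (i : Fin (d + 1)) :
    (∑ r, c r • (Y r * Φ.E r)) * Φ.E i = c i • (Y i * Φ.E i) := by
  rw [Finset.sum_mul, Finset.sum_eq_single i]
  · rw [smul_mul_assoc, mul_assoc, Φ.idem.mul_eq e, if_pos rfl]
  · intro r _ hr
    rw [smul_mul_assoc, mul_assoc, Φ.idem.mul_eq e, if_neg hr, mul_zero, smul_zero]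
  · simp

end LeonardSystem

/-! ### The antiautomorphism and the bilinear form -/

theorem unop_aeval_eq_of_unop_eq {K 𝒜 : Type*} [Field K] [Ring 𝒜] [Algebra K 𝒜]
    (σ : 𝒜 ≃ₐ[K] 𝒜ᵐᵒᵖ) {A : 𝒜} (hA : (σ A).unop = A) (p : K[X]) :
    (σ (aeval A p)).unop = aeval A p := by
  induction p using Polynomial.induction_on' with
  | add p q hp hq => rw [map_add, map_add, MulOpposite.unop_add, hp, hq]
  | monomial n a =>
    rw [aeval_monomial, map_mul, map_pow, MulOpposite.unop_mul, MulOpposite.unop_pow, hA,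
      AlgEquiv.commutes, MulOpposite.algebraMap_apply, MulOpposite.unop_op, Algebra.commutes]

namespace LeonardSystem

variable {K 𝒜 : Type*} [Field K] [Ring 𝒜] [Algebra K 𝒜] {d : ℕ}
  (e : 𝒜 ≃ₐ[K] Matrix (Fin (d + 1)) (Fin (d + 1)) K) {Φ : LeonardSystem K 𝒜 d}
  {σ : 𝒜 ≃ₐ[K] 𝒜ᵐᵒᵖ}

theorem IsDagger.unop_E (hσ : Φ.IsDagger σ) (i : Fin (d + 1)) : (σ (Φ.E i)).unop = Φ.E i := by
  rw [Φ.idem.eq_aeval, unop_aeval_eq_of_unop_eq σ hσ.1]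

theorem IsDagger.unop_Es (hσ : Φ.IsDagger σ) (i : Fin (d + 1)) :
    (σ (Φ.Es i)).unop = Φ.Es i := by
  rw [Φ.idem_s.eq_aeval, unop_aeval_eq_of_unop_eq σ hσ.2]

theorem IsDagger.Es_mul_E_ne_zero (hσ : Φ.IsDagger σ) {i j : Fin (d + 1)}
    (h : Φ.E i * Φ.Es j ≠ 0) : Φ.Es j * Φ.E i ≠ 0 := by
  intro h0
  apply h
  rw [← map_eq_zero_iff σ σ.injective, ← MulOpposite.unop_eq_zero_iff, map_mul,
    MulOpposite.unop_mul, hσ.unop_E, hσ.unop_Es, h0]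

theorem IsDagger.algTrace_E_mul_Es_ne_zero (hσ : Φ.IsDagger σ) {i j : Fin (d + 1)}
    (h : Φ.E i * Φ.Es j ≠ 0) : algTrace e (Φ.E i * Φ.Es j) ≠ 0 :=
  (Φ.idem.isRankOne e i).algTrace_mul_ne_zero (Φ.idem_s.isRankOne e j) h (hσ.Es_mul_E_ne_zero h)

end LeonardSystem

section Form

theorem IsAssociatedForm.apply_smul {K 𝒜 V : Type*} [Field K] [Ring 𝒜]
    [Algebra K 𝒜] [AddCommGroup V] [Module K V] [Module 𝒜 V] {σ : 𝒜 ≃ₐ[K] 𝒜ᵐᵒᵖ} {B : LinearMap.BilinForm K V}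
    (hB : IsAssociatedForm σ B) {P : 𝒜} (hP : (σ P).unop = P) (u v : V) :
    B u (P • v) = B (P • u) v := by
  rw [hB.2, hP]

variable {K 𝒜 V : Type*} [Field K] [Ring 𝒜] [Algebra K 𝒜]
  [AddCommGroup V] [Module K V] [Module 𝒜 V] [IsScalarTower K 𝒜 V] [IsSimpleModule 𝒜 V]
  {d : ℕ} {e : 𝒜 ≃ₐ[K] Matrix (Fin (d + 1)) (Fin (d + 1)) K}

/-- The image of a rank-one element on the simple module is a line. -/
theorem IsRankOne.exists_smul_eq_smul {P : 𝒜} (hP : IsRankOne e P) {x : V} (hx : x ≠ 0)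
    (hPx : P • x = x) (v : V) : ∃ c : K, P • v = c • x := by
  obtain ⟨W, rfl⟩ := IsSimpleModule.toSpanSingleton_surjective 𝒜 hx v
  refine ⟨algTrace e (W * P), ?_⟩
  rw [LinearMap.toSpanSingleton_apply]
  nth_rewrite 1 [← hPx]
  rw [smul_smul, smul_smul, hP.mul_mul_self, smul_assoc, hPx]

/-- Generators `x`, `y` of the images of `P = P^†` and `Q` are not orthogonal unless `P Q = 0`:
since `P 𝒜 Q` is a line, the form would vanish identically. -/
theorem IsAssociatedForm.apply_ne_zero {σ : 𝒜 ≃ₐ[K] 𝒜ᵐᵒᵖ} {B : LinearMap.BilinForm K V}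
    (hB : IsAssociatedForm σ B) {P Q : 𝒜} (hP : IsRankOne e P) (hQ : IsRankOne e Q)
    (hPQ : P * Q ≠ 0) (hσP : (σ P).unop = P) {x y : V} (hx : x ≠ 0) (hy : y ≠ 0)
    (hPx : P • x = x) (hQy : Q • y = y) : B x y ≠ 0 := by
  intro h0
  apply hB.1
  ext u v
  obtain ⟨Y, rfl⟩ := IsSimpleModule.toSpanSingleton_surjective 𝒜 hx u
  obtain ⟨Z, rfl⟩ := IsSimpleModule.toSpanSingleton_surjective 𝒜 hy v
  obtain ⟨c, hc⟩ := hP.exists_mul_mul_eq_smul hQ hPQ ((σ Y).unop * Z)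
  rw [LinearMap.toSpanSingleton_apply, LinearMap.toSpanSingleton_apply, hB.2, ← hPx, ← hQy,
    ← hB.apply_smul hσP, smul_smul, smul_smul, smul_smul]
  have : P * ((σ Y).unop * (Z * Q)) = c • (P * Q) := by rw [← hc]; simp only [mul_assoc]
  simp only [mul_assoc] at this ⊢
  rw [this, smul_assoc, map_smul, mul_smul, hQy, hB.apply_smul hσP, hPx, h0]
  simp

/-- Expansion of `P y` along `x`, read off by pairing with `x`. -/
theorem IsAssociatedForm.div_smul_smul {σ : 𝒜 ≃ₐ[K] 𝒜ᵐᵒᵖ} {B : LinearMap.BilinForm K V}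
    (hB : IsAssociatedForm σ B) {P : 𝒜} (hP : IsRankOne e P) (hσP : (σ P).unop = P) {x y : V}
    (hx : x ≠ 0) (hPx : P • x = x) (hxy : B x y ≠ 0) : (B x x / B x y) • (P • y) = x := by
  obtain ⟨c, hc⟩ := hP.exists_smul_eq_smul hx hPx y
  have h1 : B x y = c * B x x := by
    rw [← smul_eq_mul, ← map_smul, ← hc, hB.apply_smul hσP, hPx]
  rw [hc, smul_smul]
  have h2 : B x x / B x y * c = 1 := by
    rw [div_mul_eq_mul_div, mul_comm, ← h1, div_self hxy]
  rw [h2, one_smul]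

end Form

/-! ### The transition maps -/

theorem smul_eq_self_of_mem_range {R V : Type*} [Ring R] [AddCommGroup V] [Module R V] {P : R}
    (hP : P * P = P) {x : V} (hx : x ∈ Set.range fun v : V => P • v) : P • x = x := by
  obtain ⟨v, rfl⟩ := hx
  simp only [smul_smul, hP]

namespace LeonardSystem

variable {K 𝒜 V : Type*} [Field K] [Ring 𝒜] [Algebra K 𝒜]
  [AddCommGroup V] [Module K V] [Module 𝒜 V] [IsScalarTower K 𝒜 V]
  {d : ℕ} (e : 𝒜 ≃ₐ[K] Matrix (Fin (d + 1)) (Fin (d + 1)) K) {Φ : LeonardSystem K 𝒜 d}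
  {σ : 𝒜 ≃ₐ[K] 𝒜ᵐᵒᵖ} {B : LinearMap.BilinForm K V}

theorem sum_smul_smul (e : 𝒜 ≃ₐ[K] Matrix (Fin (d + 1)) (Fin (d + 1)) K)
    (Φ : LeonardSystem K 𝒜 d) (c : Fin (d + 1) → K) (Y : Fin (d + 1) → 𝒜)
    (i : Fin (d + 1)) (x : V) :
    (∑ r, c r • (Y r * Φ.E r)) • (Φ.E i • x) = c i • (Y i • (Φ.E i • x)) := by
  rw [smul_smul, Φ.sum_smul_mul_mul e, smul_assoc, mul_smul]

/-- `E^*_d E_i` scaled by `tr(E_i E^*_d)⁻¹` fixes `ξ^*_d`, because `E^*_d` has rank one. -/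
theorem sum_inv_algTrace_smul (hσ : Φ.IsDagger σ) (Y : Fin (d + 1) → 𝒜) (i : Fin (d + 1)) {x : V}
    (hx : Φ.Es (Fin.last d) • x = x) :
    (∑ r, (algTrace e (Φ.E r * Φ.Es (Fin.last d)))⁻¹ •
      (Y r * Φ.Es (Fin.last d) * Φ.E r)) • (Φ.E i • x) = Y i • x := by
  have htr := hσ.algTrace_E_mul_Es_ne_zero e (Φ.E_mul_Es_last_ne_zero e i)
  rw [sum_smul_smul e Φ _ (fun r => Y r * Φ.Es (Fin.last d)), mul_smul]
  nth_rewrite 1 [← hx]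
  rw [smul_smul (Φ.E i), smul_smul (Φ.Es _), ← mul_assoc,
    (Φ.idem_s.isRankOne e _).mul_mul_self, smul_assoc, hx, smul_comm (Y i), smul_smul,
    inv_mul_cancel₀ htr, one_smul]

/-- The scalar making `E^*_0 E_i` carry `ξ^*_d` to `ξ^*_0`. It does not depend on `i` apart from the
factor `∏_{j ≠ i} (θ_i - θ_j)`, so it can be computed at `i = d` by pairing with `ξ_d`. -/
theorem smul_Es_zero_smul_E_smul [IsSimpleModule 𝒜 V] (hσ : Φ.IsDagger σ)
    (hB : IsAssociatedForm σ B) {xd xs0 xsd : V} (hxs0 : xs0 ≠ 0)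
    (hd : Φ.E (Fin.last d) • xd = xd) (hs0 : Φ.Es 0 • xs0 = xs0)
    (hsd : Φ.Es (Fin.last d) • xsd = xsd) (hne : B xd xsd ≠ 0) (i : Fin (d + 1)) :
    ((etaPoly Φ.θs d).eval (Φ.θs 0) / Φ.firstSplitProd e * (B xd xs0 / B xd xsd)) •
      (∏ j ∈ Finset.univ.erase i, (Φ.θ i - Φ.θ j)) • (Φ.Es 0 • (Φ.E i • xsd)) = xs0 := by
  have hcorner : ∀ r, (∏ j ∈ Finset.univ.erase r, (Φ.θ r - Φ.θ j)) •
      (Φ.Es 0 • (Φ.E r • xsd)) = (Φ.Es 0 * Φ.A ^ d * Φ.Es (Fin.last d)) • xsd := by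
    intro r
    rw [← Φ.prod_sub_smul_corner e r, smul_assoc, mul_smul, mul_smul, hsd]
  rw [hcorner i, ← hcorner (Fin.last d)]
  obtain ⟨c, hc⟩ := (Φ.idem_s.isRankOne e 0).exists_smul_eq_smul hxs0 hs0
    (Φ.E (Fin.last d) • xsd)
  have hpair : c * B xd xs0 = algTrace e (Φ.E (Fin.last d) * Φ.Es 0) * B xd xsd := by
    rw [← smul_eq_mul, ← map_smul, ← hc, hB.apply_smul (hσ.unop_Es 0),
      hB.apply_smul (hσ.unop_E _)]
    nth_rewrite 1 [← hd]
    rw [smul_smul, smul_smul, (Φ.idem.isRankOne e _).mul_mul_self, smul_assoc, hd,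
      map_smul, LinearMap.smul_apply, smul_eq_mul]
    congr 1
    rw [algTrace, algTrace, map_mul, map_mul, Matrix.trace_mul_comm]
  have heta := Φ.eval_etaPoly_dual_ne_zero
  have hs := Φ.splitTrace_ne_zero e (Fin.last d)
  rw [Fin.val_last, Φ.splitTrace_diameter e] at hs
  obtain ⟨hk, htr⟩ := mul_ne_zero_iff.mp hs
  rw [hc, smul_smul, smul_smul, Φ.firstSplitProd_eq e, Φ.splitTrace_diameter e]
  generalize (∏ j ∈ Finset.univ.erase (Fin.last d), (Φ.θ (Fin.last d) - Φ.θ j)) = k at *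
  generalize algTrace e (Φ.E (Fin.last d) * Φ.Es 0) = t at *
  generalize (etaPoly Φ.θs d).eval (Φ.θs 0) = n at *
  have : n / (n * (k * t)) * (B xd xs0 / B xd xsd) * k * c = 1 := by
    field_simp
    linear_combination hpair
  rw [this, one_smul]

theorem sum_Es_zero_smul [IsSimpleModule 𝒜 V] (hσ : Φ.IsDagger σ)
    (hB : IsAssociatedForm σ B) {xd xs0 xsd : V} (hxs0 : xs0 ≠ 0)
    (hd : Φ.E (Fin.last d) • xd = xd) (hs0 : Φ.Es 0 • xs0 = xs0)
    (hsd : Φ.Es (Fin.last d) • xsd = xsd) (hne : B xd xsd ≠ 0)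
    (Y : Fin (d + 1) → 𝒜) (i : Fin (d + 1)) :
    (((etaPoly Φ.θs d).eval (Φ.θs 0) / Φ.firstSplitProd e * (B xd xs0 / B xd xsd)) •
      ∑ r : Fin (d + 1),
        ((tauPoly Φ.θ r).eval (Φ.θ r) * (etaPoly Φ.θ (d - r)).eval (Φ.θ r)) •
          (Y r * Φ.Es 0 * Φ.E r)) • (Φ.E i • xsd) = Y i • xs0 := by
  rw [smul_assoc, sum_smul_smul e Φ _ (fun r => Y r * Φ.Es 0), eval_tauPoly_mul_eval_etaPoly,
    mul_smul (Y i), ← smul_comm (Y i), ← smul_comm (Y i),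
    smul_Es_zero_smul_E_smul e hσ hB hxs0 hd hs0 hsd hne]

theorem sum_E_Es_last_smul [IsSimpleModule 𝒜 V] (hσ : Φ.IsDagger σ)
    (hB : IsAssociatedForm σ B) {j : Fin (d + 1)} {x xsd : V} (hx0 : x ≠ 0)
    (hx : Φ.E j • x = x) (hsd : Φ.Es (Fin.last d) • xsd = xsd) (hne : B x xsd ≠ 0)
    (Y : Fin (d + 1) → 𝒜) (i : Fin (d + 1)) :
    ((B x x / B x xsd) • ∑ r : Fin (d + 1), (algTrace e (Φ.E r * Φ.Es (Fin.last d)))⁻¹ •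
      (Y r * Φ.E j * Φ.Es (Fin.last d) * Φ.E r)) • (Φ.E i • xsd) = Y i • x := by
  rw [smul_assoc, sum_inv_algTrace_smul e hσ (fun r => Y r * Φ.E j) i hsd, mul_smul,
    ← smul_comm (Y i), hB.div_smul_smul (Φ.idem.isRankOne e j) (hσ.unop_E j) hx0 hx hne]

end LeonardSystem

theorem theorem11p1 {K 𝒜 V : Type*} [Field K] [Ring 𝒜] [Algebra K 𝒜]
    [AddCommGroup V] [Module K V] [Module 𝒜 V] [IsScalarTower K 𝒜 V] [IsSimpleModule 𝒜 V]
    {d : ℕ} (e : 𝒜 ≃ₐ[K] Matrix (Fin (d + 1)) (Fin (d + 1)) K)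
    (Φ : LeonardSystem K 𝒜 d)
    (σ : 𝒜 ≃ₐ[K] 𝒜ᵐᵒᵖ) (hσ : Φ.IsDagger σ)
    (B : LinearMap.BilinForm K V) (hB : IsAssociatedForm σ B)
    (ξ0 ξd ξs0 ξsd : V) (hξ0 : ξ0 ≠ 0) (hξd : ξd ≠ 0) (hξs0 : ξs0 ≠ 0) (hξsd : ξsd ≠ 0)
    (mem_ξ0 : ξ0 ∈ Set.range (fun v : V => Φ.E 0 • v))
    (mem_ξd : ξd ∈ Set.range (fun v : V => Φ.E (Fin.last d) • v))
    (mem_ξs0 : ξs0 ∈ Set.range (fun v : V => Φ.Es 0 • v))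
    (mem_ξsd : ξsd ∈ Set.range (fun v : V => Φ.Es (Fin.last d) • v)) :
    -- every denominator occurring below is nonzero
    ((∀ i : Fin d, Φ.splitTrace e i ≠ 0) ∧ Φ.firstSplitProd e ≠ 0 ∧
      (∀ r, algTrace e (Φ.E r * Φ.Es (Fin.last d)) ≠ 0) ∧ B ξ0 ξsd ≠ 0 ∧ B ξd ξsd ≠ 0) ∧
    -- part (i)
    (∀ X : Fin (d + 1) → 𝒜, Φ.IsSeq X → ∀ i : Fin (d + 1),
      (((etaPoly Φ.θs d).eval (Φ.θs 0) / Φ.firstSplitProd e * (B ξd ξs0 / B ξd ξsd)) •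
          ∑ r : Fin (d + 1),
            ((tauPoly Φ.θ r).eval (Φ.θ r) * (etaPoly Φ.θ (d - r)).eval (Φ.θ r)) •
              (X r * Φ.Es 0 * Φ.E r)) • (Φ.E i • ξsd) = X i • ξs0 ∧
      (∑ r : Fin (d + 1), (algTrace e (Φ.E r * Φ.Es (Fin.last d)))⁻¹ •
          (X r * Φ.Es (Fin.last d) * Φ.E r)) • (Φ.E i • ξsd) = X i • ξsd ∧
      (((etaPoly Φ.θs d).eval (Φ.θs 0) / Φ.firstSplitProd e * (B ξd ξs0 / B ξd ξsd)) •
          ∑ r : Fin (d + 1),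
            ((tauPoly Φ.θ r).eval (Φ.θ r) * (etaPoly Φ.θ (d - r)).eval (Φ.θ r)) •
              (X r.rev * Φ.Es 0 * Φ.E r)) • (Φ.E i.rev • ξsd) = X i • ξs0 ∧
      (∑ r : Fin (d + 1), (algTrace e (Φ.E r * Φ.Es (Fin.last d)))⁻¹ •
          (X r.rev * Φ.Es (Fin.last d) * Φ.E r)) • (Φ.E i.rev • ξsd) = X i • ξsd) ∧
    -- part (ii)
    (∀ X : Fin (d + 1) → 𝒜, Φ.IsDualSeq X → ∀ i : Fin (d + 1),
      ((B ξ0 ξ0 / B ξ0 ξsd) •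
          ∑ r : Fin (d + 1), (algTrace e (Φ.E r * Φ.Es (Fin.last d)))⁻¹ •
            (X r * Φ.E 0 * Φ.Es (Fin.last d) * Φ.E r)) • (Φ.E i • ξsd) = X i • ξ0 ∧
      ((B ξd ξd / B ξd ξsd) •
          ∑ r : Fin (d + 1), (algTrace e (Φ.E r * Φ.Es (Fin.last d)))⁻¹ •
            (X r * Φ.E (Fin.last d) * Φ.Es (Fin.last d) * Φ.E r)) • (Φ.E i • ξsd) = X i • ξd ∧
      ((B ξ0 ξ0 / B ξ0 ξsd) •
          ∑ r : Fin (d + 1), (algTrace e (Φ.E r * Φ.Es (Fin.last d)))⁻¹ •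
            (X r.rev * Φ.E 0 * Φ.Es (Fin.last d) * Φ.E r)) • (Φ.E i.rev • ξsd) = X i • ξ0 ∧
      ((B ξd ξd / B ξd ξsd) •
          ∑ r : Fin (d + 1), (algTrace e (Φ.E r * Φ.Es (Fin.last d)))⁻¹ •
            (X r.rev * Φ.E (Fin.last d) * Φ.Es (Fin.last d) * Φ.E r)) •
              (Φ.E i.rev • ξsd) = X i • ξd) := by
  have hEE : ∀ i, Φ.E i * Φ.E i = Φ.E i := fun i => by rw [Φ.idem.mul_eq e, if_pos rfl]
  have hEsEs : ∀ i, Φ.Es i * Φ.Es i = Φ.Es i := fun i => by rw [Φ.idem_s.mul_eq e, if_pos rfl]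
  have h0 := smul_eq_self_of_mem_range (hEE _) mem_ξ0
  have hd := smul_eq_self_of_mem_range (hEE _) mem_ξd
  have hs0 := smul_eq_self_of_mem_range (hEsEs _) mem_ξs0
  have hsd := smul_eq_self_of_mem_range (hEsEs _) mem_ξsd
  have hne : ∀ (j : Fin (d + 1)) (x : V), x ≠ 0 → Φ.E j • x = x → B x ξsd ≠ 0 :=
    fun j x hx0 hx => hB.apply_ne_zero (Φ.idem.isRankOne e j) (Φ.idem_s.isRankOne e _)
      (Φ.E_mul_Es_last_ne_zero e j) (hσ.unop_E j) hx0 hξsd hx hsd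
  have hne0 := hne 0 ξ0 hξ0 h0
  have hned := hne (Fin.last d) ξd hξd hd
  refine ⟨⟨fun i => Φ.splitTrace_ne_zero e i.castSucc, ?_,
    fun r => hσ.algTrace_E_mul_Es_ne_zero e (Φ.E_mul_Es_last_ne_zero e r), hne0, hned⟩,
    fun X _ i => ⟨?_, ?_, ?_, ?_⟩, fun X _ i => ⟨?_, ?_, ?_, ?_⟩⟩
  · rw [Φ.firstSplitProd_eq e]
    exact mul_ne_zero Φ.eval_etaPoly_dual_ne_zero (Φ.splitTrace_ne_zero e (Fin.last d))
  · exact LeonardSystem.sum_Es_zero_smul e hσ hB hξs0 hd hs0 hsd hned X i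
  · exact LeonardSystem.sum_inv_algTrace_smul e hσ X i hsd
  · simpa only [Fin.rev_rev] using LeonardSystem.sum_Es_zero_smul e hσ hB hξs0 hd hs0 hsd hned
      (fun r => X r.rev) i.rev
  · simpa only [Fin.rev_rev] using LeonardSystem.sum_inv_algTrace_smul e hσ
      (fun r => X r.rev) i.rev hsd
  · exact LeonardSystem.sum_E_Es_last_smul e hσ hB hξ0 h0 hsd hne0 X i
  · exact LeonardSystem.sum_E_Es_last_smul e hσ hB hξd hd hsd hned X i
  · simpa only [Fin.rev_rev] using LeonardSystem.sum_E_Es_last_smul e hσ hB hξ0 h0 hsd hne0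
      (fun r => X r.rev) i.rev
  · simpa only [Fin.rev_rev] using LeonardSystem.sum_E_Es_last_smul e hσ hB hξd hd hsd hned
      (fun r => X r.rev) i.rev
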